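/- Let $E$ be a real Banach lattice and let $T=(T(t))_{t\ge 0}$ be a positive $C_0$-semigroup on $E$, i.e. a strongly continuous semigroup of bounded linear operators on $E$ (so $T(0)=\mathrm{id}_E$ and $T(s+t)=T(s)T(t)$ for all $s,t\ge 0$) such that $T(t)x\ge 0$ whenever $x \ge 0$ and $t\ge 0$. Then the following four assertions are equivalent: (i) $T$ is relatively uniformly continuous: for each $x\in E$ one has $T(t)x\xrightarrow{\mathrm{ru}}x$ as $t\downarrow 0$, i.e. there is $0 \le u\in E$ such that for every $\varepsilon>0$ there is $s>0$ with $|T(t)x-x|\le\varepsilon u$ for all $t\in(0,s]$. (ii) For each $x\in E$ one has $T(t)x\xrightarrow{\mathrm{o}}x$ as $t\downarrow 0$, i.e. there is a decreasing net $(y_h)_{h\in H}$ of positive vectors in $E$ with infimum $0$ such that for every $h\in H$ there is $s>0$ with $|T(t)x-x|\le y_h$ for all $t\in(0,s]$. (iii) For each $x\in E$ there exists $t_x>0$ such that the set $\{T(t)x : t\in[0,t_x]\}$ is order bounded in $E$, i.e. contained in an order interval $[a,b] = \{z \in E : a\le z\le b\}$ with $a,b\in E$. (iv) For each $x\in E$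 and each $t_0>0$ the set $\{T(t)x : t\in[0,t_0]\}$ is order bounded in $E$. -/

import Mathlib

open scoped NNReal

universe u v

/-- Order convergence of a net `x : J → E` to `a` in a vector lattice: there is a decreasing net
`y : H → E` of positive vectors with infimum `0` such that for each `h` one has
`|x j - a| ≤ y h` for all sufficiently large `j`. Only the range of the net `y` matters, and this
range is a downward directed subset of `E`; so index sets `H` in the universe of `E` suffice. -/
def NetOrderConverges {E : Type u} [AddCommGroup E] [Lattice E]
    {J : Type v} [Preorder J] [IsDirectedOrder J] [Nonempty J] (x : J → E) (a : E) : Prop :=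
  ∃ (H : Type u) (_ : Preorder H) (_ : IsDirectedOrder H) (_ : Nonempty H) (y : H → E),
    Antitone y ∧ (∀ h, 0 ≤ y h) ∧ IsGLB (Set.range y) 0 ∧
      ∀ h, ∃ j₀ : J, ∀ j, j₀ ≤ j → |x j - a| ≤ y h

/-- Relatively uniform convergence of a net `x : J → E` to `a` in a vector lattice, with some
regulator `r`. -/
def NetRUConverges {E : Type u} [AddCommGroup E] [Lattice E] [Module ℝ E]
    {J : Type v} [Preorder J] [IsDirectedOrder J] [Nonempty J] (x : J → E) (a : E) : Prop :=
  ∃ r : E, 0 ≤ r ∧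
    ∀ ε : ℝ, 0 < ε → ∃ j₀ : J, ∀ j, j₀ ≤ j → |x j - a| ≤ ε • r

/-- The index set `(0, ∞)`, directed conversely to the order inherited from `ℝ`; nets over it
express limits as `t ↓ 0`. -/
abbrev TimeToZero : Type := (Set.Ioi (0 : ℝ≥0))ᵒᵈ

/-- The time `t ∈ (0, ∞)` belonging to an index. -/
def TimeToZero.time (j : TimeToZero) : ℝ≥0 := (OrderDual.ofDual j : Set.Ioi (0 : ℝ≥0))

/-- A subset of a partially ordered space is order bounded if it lies in an order interval. -/
def IsOrderBdd {E : Type u} [Preorder E] (s : Set E) : Prop :=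
  ∃ a b : E, s ⊆ Set.Icc a b

/-- `T` is a positive `C₀`-semigroup: a strongly continuous one-parameter semigroup of bounded
linear operators that map positive vectors to positive vectors. -/
structure IsPositiveC0Semigroup {E : Type u} [NormedAddCommGroup E] [NormedSpace ℝ E]
    [Lattice E] (T : ℝ≥0 → E →L[ℝ] E) : Prop where
  map_zero : T 0 = ContinuousLinearMap.id ℝ E
  map_add : ∀ s t : ℝ≥0, T (s + t) = (T s).comp (T t)
  continuous_orbit : ∀ x : E, Continuous fun t : ℝ≥0 => T t x
  positive : ∀ (t : ℝ≥0) (x : E), 0 ≤ x → 0 ≤ T t x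

/-! Only the passage from order bounded orbits to relatively uniform convergence is deep. The
averages y = h⁻¹ ∫₀ʰ T(s)x ds approximate x in norm, and T(t)y - y is an integral over two intervals
of length t, so it is dominated by a multiple of t (`exists_approx_abs_sub_le_smul`). A gliding hump
argument (`exists_uniform_dominating_bound`) dominates the remainder T(t)(x - y) - (x - y) by a
vector of small norm. Hence |T(t)x - x| ≤ u + tv with ‖u‖ as small as desired, and a weighted series
of such u and v is a single regulator (`exists_regulator_of_forall_le_add_smul`). -/

section OrderedGroup

theorem IsOrderBdd.exists_abs_le {E : Type*} [AddCommGroup E] [Lattice E] [IsOrderedAddMonoid E]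
    {s : Set E} (hs : IsOrderBdd s) : ∃ u : E, 0 ≤ u ∧ ∀ x ∈ s, |x| ≤ u := by
  obtain ⟨a, b, hab⟩ := hs
  refine ⟨|a| ⊔ |b|, (abs_nonneg a).trans le_sup_left, fun x hx => abs_le'.2 ⟨?_, ?_⟩⟩
  · exact (hab hx).2.trans ((le_abs_self b).trans le_sup_right)
  · exact (neg_le_neg (hab hx).1).trans ((neg_le_abs a).trans le_sup_left)

theorem isOrderBdd_of_abs_sub_le {E : Type*} [AddCommGroup E] [Lattice E] [IsOrderedAddMonoid E]
    {s : Set E} {x y : E} (h : ∀ z ∈ s, |z - x| ≤ y) : IsOrderBdd s := by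
  refine ⟨x - y, x + y, fun z hz => ⟨?_, ?_⟩⟩
  · have := (neg_le_abs (z - x)).trans (h z hz)
    rw [neg_sub] at this
    exact sub_le_comm.1 this
  · exact sub_le_iff_le_add'.1 ((le_abs_self _).trans (h z hz))

theorem IsOrderBdd.union {E : Type*} [Lattice E] {s t : Set E} (hs : IsOrderBdd s)
    (ht : IsOrderBdd t) : IsOrderBdd (s ∪ t) := by
  obtain ⟨a, b, hab⟩ := hs
  obtain ⟨c, d, hcd⟩ := ht
  exact ⟨a ⊓ c, b ⊔ d, Set.union_subset
    (hab.trans (Set.Icc_subset_Icc inf_le_left le_sup_left))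
    (hcd.trans (Set.Icc_subset_Icc inf_le_right le_sup_right))⟩

theorem IsOrderBdd.mono {E : Type*} [Preorder E] {s t : Set E} (ht : IsOrderBdd t) (h : s ⊆ t) :
    IsOrderBdd s := by
  obtain ⟨a, b, hab⟩ := ht
  exact ⟨a, b, h.trans hab⟩

theorem IsOrderBdd.image {E F : Type*} [Preorder E] [Preorder F] {s : Set E} (hs : IsOrderBdd s)
    {f : E → F} (hf : Monotone f) : IsOrderBdd (f '' s) := by
  obtain ⟨a, b, hab⟩ := hs
  refine ⟨f a, f b, ?_⟩
  rintro _ ⟨x, hx, rfl⟩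
  exact ⟨hf (hab hx).1, hf (hab hx).2⟩

theorem abs_map_le_map_abs {E F G : Type*} [AddCommGroup E] [Lattice E] [AddCommGroup F] [Lattice F]
    [FunLike G E F] [AddMonoidHomClass G E F] (S : G) (hS : Monotone S) (x : E) : |S x| ≤ S |x| :=
  abs_le'.2 ⟨hS (le_abs_self x), by rw [← map_neg]; exact hS (neg_le_abs x)⟩

end OrderedGroup

section OrderedNormedSpace

variable {E : Type u} [NormedAddCommGroup E] [NormedSpace ℝ E] [Lattice E] [IsOrderedAddMonoid E]
  {T : ℝ≥0 → E →L[ℝ] E}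

namespace IsPositiveC0Semigroup

theorem monotone (hT : IsPositiveC0Semigroup T) (t : ℝ≥0) : Monotone (T t) := fun x y hxy => by
  simpa using hT.positive t (y - x) (sub_nonneg.2 hxy)

/-- For t ≥ s, T(t)x = T(s)T(t - s)x, and the monotone T(s) preserves order boundedness; so each
bound extends by a further time s. -/
theorem isOrderBdd_orbit_of_local (hT : IsPositiveC0Semigroup T) {x : E} {s : ℝ≥0} (hs : 0 < s)
    (h : IsOrderBdd ((fun t => T t x) '' Set.Icc 0 s)) (t₀ : ℝ≥0) :
    IsOrderBdd ((fun t => T t x) '' Set.Icc 0 t₀) := by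
  have step (n : ℕ) : IsOrderBdd ((fun t => T t x) '' Set.Icc 0 (n • s)) := by
    induction n with
    | zero => exact h.mono (Set.image_mono (Set.Icc_subset_Icc_right (by simp)))
    | succ n ih =>
      refine (h.union (ih.image (hT.monotone s))).mono ?_
      rintro _ ⟨t, ht, rfl⟩
      rcases le_total t s with hts | hst
      · exact Or.inl ⟨t, ⟨zero_le, hts⟩, rfl⟩
      · refine Or.inr ⟨_, ⟨t - s, ⟨zero_le, ?_⟩, rfl⟩, ?_⟩
        · rw [tsub_le_iff_right, ← succ_nsmul]
          exact ht.2
        · change T s (T (t - s) x) = T t x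
          rw [← ContinuousLinearMap.comp_apply, ← hT.map_add, add_tsub_cancel_of_le hst]
  obtain ⟨n, hn⟩ := Archimedean.arch t₀ hs
  exact (step n).mono (Set.image_mono (Set.Icc_subset_Icc_right hn))

theorem isOrderBdd_of_netOrderConverges (hT : IsPositiveC0Semigroup T) {x : E}
    (h : NetOrderConverges (fun j : TimeToZero => T j.time x) x) :
    ∃ s : ℝ≥0, 0 < s ∧ IsOrderBdd ((fun t => T t x) '' Set.Icc 0 s) := by
  obtain ⟨H, _, _, ⟨i⟩, y, -, hy0, -, hy⟩ := h
  obtain ⟨j₀, hj⟩ := hy i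
  refine ⟨j₀.time, (OrderDual.ofDual j₀).2, isOrderBdd_of_abs_sub_le (x := x) (y := y i) ?_⟩
  rintro _ ⟨t, ht, rfl⟩
  -- Time 0 is not an index of the net.
  rcases eq_or_ne t 0 with rfl | h0
  · simpa [hT.map_zero] using hy0 i
  · exact hj (OrderDual.toDual ⟨t, pos_iff_ne_zero.2 h0⟩) ht.2

end IsPositiveC0Semigroup

end OrderedNormedSpace

section BanachLattice

variable {E : Type u} [NormedAddCommGroup E] [NormedSpace ℝ E]
  [Lattice E] [IsOrderedAddMonoid E] [IsOrderedModule ℝ E] [HasSolidNorm E]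

theorem NetRUConverges.netOrderConverges {J : Type v} [Preorder J] [IsDirectedOrder J] [Nonempty J]
    {x : J → E} {a : E} (h : NetRUConverges x a) : NetOrderConverges x a := by
  obtain ⟨r, hr, hx⟩ := h
  have hpos (n : ℕ) : (0 : ℝ) < 1 / ((n : ℝ) + 1) := Nat.one_div_pos_of_nat
  refine ⟨ULift.{u} ℕ, inferInstance, ⟨fun m n => ⟨m ⊔ n, le_sup_left, le_sup_right⟩⟩, inferInstance,
    fun n => (1 / ((n.down : ℝ) + 1)) • r, ?_, fun n => smul_nonneg (hpos _).le hr, ⟨?_, ?_⟩,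
    fun n => hx _ (hpos _)⟩
  · intro m n hmn
    exact smul_le_smul_of_nonneg_right (Nat.one_div_le_one_div hmn) hr
  · rintro _ ⟨n, rfl⟩
    exact smul_nonneg (hpos _).le hr
  · intro b hb
    -- Lower bounds survive norm limits because the order is closed.
    have hlim : Filter.Tendsto (fun n : ℕ => (1 / ((n : ℝ) + 1)) • r) Filter.atTop (nhds 0) := by
      simpa using (tendsto_one_div_add_atTop_nhds_zero_nat (𝕜 := ℝ)).smul_const r
    exact ge_of_tendsto' hlim fun n => hb ⟨⟨n⟩, rfl⟩

theorem abs_intervalIntegral_le [CompleteSpace E] {f : ℝ → E} (hf : Continuous f) {u : E} {a b : ℝ}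
    (hab : a ≤ b) (hu : ∀ s ∈ Set.Ioc a b, |f s| ≤ u) : |∫ s in a..b, f s| ≤ (b - a) • u := by
  have hconst : ∫ _ in Set.Ioc a b, u = (b - a) • u := by
    rw [← intervalIntegral.integral_of_le hab, intervalIntegral.integral_const]
  have hfi : MeasureTheory.IntegrableOn f (Set.Ioc a b) := hf.integrableOn_Ioc
  have hui : MeasureTheory.IntegrableOn (fun _ : ℝ => u) (Set.Ioc a b) :=
    continuous_const.integrableOn_Ioc
  rw [intervalIntegral.integral_of_le hab, ← hconst]
  refine abs_le'.2 ⟨?_, ?_⟩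
  · exact MeasureTheory.setIntegral_mono_on hfi hui measurableSet_Ioc
      fun s hs => (le_abs_self _).trans (hu s hs)
  · rw [← MeasureTheory.integral_neg]
    exact MeasureTheory.setIntegral_mono_on hfi.neg hui measurableSet_Ioc
      fun s hs => (neg_le_abs _).trans (hu s hs)

/-- A family of positive operators on a Banach lattice that is pointwise order bounded is dominated
with a uniform norm bound. -/
theorem exists_uniform_dominating_bound [CompleteSpace E] {ι : Type*} (S : ι → E →L[ℝ] E)
    (hS : ∀ i, Monotone (S i)) (hb : ∀ x, ∃ u, 0 ≤ u ∧ ∀ i, |S i x| ≤ u) :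
    ∃ M : ℝ, 0 < M ∧ ∀ c : ℝ, 0 < c → ∀ x : E, ‖x‖ ≤ c →
      ∃ u, 0 ≤ u ∧ ‖u‖ ≤ M * c ∧ ∀ i, |S i x| ≤ u := by
  have key : ∃ n : ℕ, ∀ x : E, 0 ≤ x → ‖x‖ ≤ 1 →
      ∃ u, 0 ≤ u ∧ ‖u‖ ≤ (4 : ℝ) ^ n ∧ ∀ i, S i x ≤ u := by
    -- Otherwise pick positive x n in the unit ball whose images have no common upper bound u ≥ 0 of
    -- norm at most 4 ^ n. If u dominates the images of ∑ 2⁻ⁿ x n, then 2 ^ n • u dominates those of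
    -- x n, with norm at most 4 ^ n once ‖u‖ < 2 ^ n.
    by_contra! hcon
    choose x hx0 hx1 hx using hcon
    have hsum : Summable fun n => ((1 / 2 : ℝ) ^ n) • x n := by
      refine Summable.of_norm_bounded summable_geometric_two fun n => ?_
      rw [norm_smul, Real.norm_of_nonneg (by positivity)]
      exact mul_le_of_le_one_right (by positivity) (hx1 n)
    obtain ⟨u, hu0, hu⟩ := hb (∑' n, ((1 / 2 : ℝ) ^ n) • x n)
    obtain ⟨n, hn⟩ := pow_unbounded_of_one_lt ‖u‖ (one_lt_two : (1 : ℝ) < 2)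
    have hle : ((1 / 2 : ℝ) ^ n) • x n ≤ ∑' n, ((1 / 2 : ℝ) ^ n) • x n :=
      hsum.le_tsum n fun m _ => smul_nonneg (by positivity) (hx0 m)
    have hnorm : ‖(2 : ℝ) ^ n • u‖ ≤ 4 ^ n := by
      rw [norm_smul, Real.norm_of_nonneg (by positivity), show (4 : ℝ) = 2 * 2 by norm_num, mul_pow]
      gcongr
    obtain ⟨i, hi⟩ := hx n _ (smul_nonneg (by positivity) hu0) hnorm
    refine hi ?_
    have h1 : x n ≤ (2 : ℝ) ^ n • ∑' n, ((1 / 2 : ℝ) ^ n) • x n := by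
      have := smul_le_smul_of_nonneg_left hle (by positivity : (0 : ℝ) ≤ 2 ^ n)
      rwa [smul_smul, ← mul_pow, mul_one_div_cancel two_ne_zero, one_pow, one_smul] at this
    refine (hS i h1).trans ?_
    rw [map_smul]
    exact smul_le_smul_of_nonneg_left ((le_abs_self _).trans (hu i)) (by positivity)
  obtain ⟨n, hn⟩ := key
  refine ⟨4 ^ n, by positivity, fun c hc x hxc => ?_⟩
  obtain ⟨u, hu0, hun, hu⟩ := hn (c⁻¹ • |x|) (smul_nonneg (by positivity) (abs_nonneg x)) (by
    rw [norm_smul, Real.norm_of_nonneg (by positivity), norm_abs_eq_norm]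
    exact inv_mul_le_one_of_le₀ hxc hc.le)
  refine ⟨c • u, smul_nonneg hc.le hu0, ?_, fun i => ?_⟩
  · rw [norm_smul, Real.norm_of_nonneg hc.le, mul_comm]
    gcongr
  · refine (abs_map_le_map_abs (S i) (hS i) x).trans ?_
    have := smul_le_smul_of_nonneg_left (hu i) hc.le
    rwa [map_smul, smul_smul, mul_inv_cancel₀ hc.ne', one_smul] at this

/-- If `|g t|` is dominated by `u + t • v` with `u` of arbitrarily small norm, then `g t` converges
relatively uniformly to `0` as `t ↓ 0`. -/
theorem exists_regulator_of_forall_le_add_smul [CompleteSpace E] {g : ℝ≥0 → E}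
    (hg : ∀ δ : ℝ, 0 < δ → ∃ u v : E, 0 ≤ u ∧ 0 ≤ v ∧ ‖u‖ ≤ δ ∧
      ∀ t : ℝ≥0, t ≤ 1 → |g t| ≤ u + (t : ℝ) • v) :
    ∃ r : E, 0 ≤ r ∧ ∀ ε : ℝ, 0 < ε → ∃ s : ℝ≥0, 0 < s ∧ ∀ t ≤ s, |g t| ≤ ε • r := by
  choose u v hu0 hv0 hu hgt using fun n : ℕ => hg ((1 / 4 : ℝ) ^ n) (by positivity)
  -- The bound 4⁻ⁿ on ‖u n‖ leaves room for the weight 2 ^ n, which gives u n ≤ 2⁻ⁿ r; the weight c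
  -- n only has to make the series of the v n converge.
  set c : ℕ → ℝ := fun n => (1 / 2) ^ n * (‖v n‖ + 1)⁻¹ with hc
  have hcpos (n : ℕ) : 0 < c n := by positivity
  have hsum : Summable fun n => (2 : ℝ) ^ n • u n + c n • v n := by
    refine Summable.of_norm_bounded (summable_geometric_two.mul_left 2) fun n => ?_
    have h1 : ‖(2 : ℝ) ^ n • u n‖ ≤ (1 / 2) ^ n := by
      rw [norm_smul, Real.norm_of_nonneg (by positivity), show (1 / 2 : ℝ) = 2 * (1 / 4) by norm_num,
        mul_pow]
      gcongr
      exact hu n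
    have h2 : ‖c n • v n‖ ≤ (1 / 2) ^ n := by
      rw [norm_smul, Real.norm_of_nonneg (hcpos n).le, hc, mul_assoc]
      refine mul_le_of_le_one_right (by positivity) (inv_mul_le_one_of_le₀ ?_ (by positivity))
      linarith
    linarith [norm_add_le ((2 : ℝ) ^ n • u n) (c n • v n)]
  have hterm (n : ℕ) : 0 ≤ (2 : ℝ) ^ n • u n + c n • v n :=
    add_nonneg (smul_nonneg (by positivity) (hu0 n)) (smul_nonneg (hcpos n).le (hv0 n))
  set r := ∑' n, ((2 : ℝ) ^ n • u n + c n • v n)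
  have hr0 : 0 ≤ r := tsum_nonneg hterm
  have hle (n : ℕ) : (2 : ℝ) ^ n • u n + c n • v n ≤ r := hsum.le_tsum n fun m _ => hterm m
  refine ⟨r, hr0, fun ε hε => ?_⟩
  obtain ⟨n, hn⟩ := exists_pow_lt_of_lt_one (half_pos hε) (one_half_lt_one : (1 / 2 : ℝ) < 1)
  have hun : u n ≤ (ε / 2) • r := by
    have h1 : (2 : ℝ) ^ n • u n ≤ r :=
      (le_add_of_nonneg_right (smul_nonneg (hcpos n).le (hv0 n))).trans (hle n)
    have h2 := smul_le_smul_of_nonneg_left h1 (by positivity : (0 : ℝ) ≤ (1 / 2) ^ n)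
    rw [smul_smul, ← mul_pow, one_div_mul_cancel two_ne_zero, one_pow, one_smul] at h2
    exact h2.trans (smul_le_smul_of_nonneg_right hn.le hr0)
  have hvn : c n • v n ≤ r :=
    (le_add_of_nonneg_left (smul_nonneg (by positivity) (hu0 n))).trans (hle n)
  refine ⟨min 1 (ε / 2 * c n).toNNReal, lt_min one_pos (Real.toNNReal_pos.2
    (mul_pos (half_pos hε) (hcpos n))), fun t ht => (hgt n t (ht.trans (min_le_left _ _))).trans ?_⟩
  have ht' : (t : ℝ) ≤ ε / 2 * c n := by
    rw [← Real.coe_toNNReal _ (mul_pos (half_pos hε) (hcpos n)).le]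
    exact NNReal.coe_le_coe.2 (ht.trans (min_le_right _ _))
  have htv : (t : ℝ) • v n ≤ (ε / 2) • r := by
    refine (smul_le_smul_of_nonneg_right ht' (hv0 n)).trans ?_
    rw [mul_smul]
    exact smul_le_smul_of_nonneg_left hvn (half_pos hε).le
  calc u n + (t : ℝ) • v n ≤ (ε / 2) • r + (ε / 2) • r := add_le_add hun htv
    _ = ε • r := by rw [← add_smul, add_halves]

namespace IsPositiveC0Semigroup

variable {T : ℝ≥0 → E →L[ℝ] E}

/-- Averages of an order bounded orbit approximate its starting point, and on them the semigroup is
dominated by a multiple of time. -/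
theorem exists_approx_abs_sub_le_smul [CompleteSpace E] (hT : IsPositiveC0Semigroup T) {x u : E}
    (hu0 : 0 ≤ u) (hu : ∀ t ≤ 2, |T t x| ≤ u) {δ : ℝ} (hδ : 0 < δ) :
    ∃ y v : E, 0 ≤ v ∧ ‖x - y‖ ≤ δ ∧ ∀ t : ℝ≥0, t ≤ 1 → |T t y - y| ≤ (t : ℝ) • v := by
  set f : ℝ → E := fun s => T s.toNNReal x with hf
  have hfc : Continuous f := (hT.continuous_orbit x).comp continuous_real_toNNReal
  have hf0 : f 0 = x := by simp [hf, hT.map_zero]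
  have hfu (s : ℝ) (hs : s ≤ 2) : |f s| ≤ u := hu _ (by simpa using hs)
  obtain ⟨η, hη, hclose⟩ := Metric.continuousAt_iff.1 hfc.continuousAt δ hδ
  -- With h ≤ 1 and t ≤ 1, all times up to h + t stay in [0, 2], where u dominates.
  set h : ℝ := min 1 (η / 2)
  have hpos : 0 < h := lt_min one_pos (half_pos hη)
  have hh1 : h ≤ 1 := min_le_left _ _
  have hint (a b : ℝ) : IntervalIntegrable f MeasureTheory.volume a b :=
    hfc.intervalIntegrable a b
  refine ⟨h⁻¹ • ∫ s in (0 : ℝ)..h, f s, (2 * h⁻¹) • u, smul_nonneg (by positivity) hu0, ?_, ?_⟩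
  · have hx : x = h⁻¹ • ∫ _ in (0 : ℝ)..h, x := by
      rw [intervalIntegral.integral_const, sub_zero, smul_smul, inv_mul_cancel₀ hpos.ne', one_smul]
    have hbound : ‖∫ s in (0 : ℝ)..h, (x - f s)‖ ≤ δ * |h - 0| := by
      refine intervalIntegral.norm_integral_le_of_norm_le_const fun s hs => ?_
      rw [Set.uIoc_of_le hpos.le] at hs
      have hsη : dist s 0 < η := by
        rw [Real.dist_0_eq_abs, abs_of_pos hs.1]
        linarith [hs.2, min_le_right 1 (η / 2)]
      have := hclose hsη
      rw [hf0, dist_eq_norm, norm_sub_rev] at this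
      exact this.le
    nth_rewrite 1 [hx]
    rw [← smul_sub, ← intervalIntegral.integral_sub (by simp) (hint 0 h), norm_smul,
      Real.norm_of_nonneg (inv_pos.2 hpos).le]
    rw [sub_zero, abs_of_pos hpos] at hbound
    rw [inv_mul_le_iff₀ hpos, mul_comm h δ]
    exact hbound
  · intro t ht
    have ht1 : (t : ℝ) ≤ 1 := by exact_mod_cast ht
    have hshift : T t (∫ s in (0 : ℝ)..h, f s) = ∫ s in (t : ℝ)..(h + t), f s := by
      rw [← ContinuousLinearMap.intervalIntegral_comp_comm _ (hint 0 h)]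
      have := intervalIntegral.integral_comp_add_right (a := 0) (b := h) f (t : ℝ)
      rw [zero_add] at this
      rw [← this]
      refine intervalIntegral.integral_congr fun s hs => ?_
      rw [Set.uIcc_of_le hpos.le] at hs
      simp only [hf]
      rw [← ContinuousLinearMap.comp_apply, ← hT.map_add, Real.toNNReal_add hs.1 t.coe_nonneg,
        Real.toNNReal_coe, add_comm]
    -- The common part of the integrals over [t, h + t] and [0, h] cancels.
    have hdiff : T t (h⁻¹ • ∫ s in (0 : ℝ)..h, f s) - h⁻¹ • ∫ s in (0 : ℝ)..h, f s
        = h⁻¹ • ((∫ s in h..(h + t), f s) - ∫ s in (0 : ℝ)..t, f s) := by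
      rw [map_smul, hshift, ← smul_sub,
        intervalIntegral.integral_interval_sub_interval_comm' (hint _ _) (hint _ _) (hint _ _)]
    have hb1 : |∫ s in h..(h + t), f s| ≤ (t : ℝ) • u := by
      have := abs_intervalIntegral_le hfc (le_add_of_nonneg_right t.2)
        fun s (hs : s ∈ Set.Ioc h (h + t)) => hfu s (by linarith [hs.2])
      rwa [add_sub_cancel_left] at this
    have hb2 : |∫ s in (0 : ℝ)..t, f s| ≤ (t : ℝ) • u := by
      have := abs_intervalIntegral_le hfc t.2
        fun s (hs : s ∈ Set.Ioc 0 (t : ℝ)) => hfu s (by linarith [hs.2])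
      rwa [sub_zero] at this
    have hb : |(∫ s in h..(h + t), f s) - ∫ s in (0 : ℝ)..t, f s| ≤ (2 * (t : ℝ)) • u := by
      rw [sub_eq_add_neg, two_mul, add_smul]
      refine (abs_add_le _ _).trans (add_le_add hb1 ?_)
      rwa [abs_neg]
    rw [hdiff]
    have hsm : (t : ℝ) • (2 * h⁻¹) • u = h⁻¹ • (2 * (t : ℝ)) • u := by
      rw [smul_smul, smul_smul]
      ring_nf
    rw [hsm]
    have hi := (inv_pos.2 hpos).le
    refine abs_le'.2 ⟨smul_le_smul_of_nonneg_left ((le_abs_self _).trans hb) hi, ?_⟩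
    rw [← smul_neg]
    exact smul_le_smul_of_nonneg_left ((neg_le_abs _).trans hb) hi

theorem netRUConverges_of_isOrderBdd [CompleteSpace E] (hT : IsPositiveC0Semigroup T)
    (h : ∀ x : E, ∀ t₀ : ℝ≥0, 0 < t₀ → IsOrderBdd ((fun t => T t x) '' Set.Icc 0 t₀)) (x : E) :
    NetRUConverges (fun j : TimeToZero => T j.time x) x := by
  have hb (x : E) : ∃ u, 0 ≤ u ∧ ∀ t ≤ 2, |T t x| ≤ u := by
    obtain ⟨u, hu0, hu⟩ := (h x 2 two_pos).exists_abs_le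
    exact ⟨u, hu0, fun t ht => hu _ ⟨t, ⟨zero_le, ht⟩, rfl⟩⟩
  obtain ⟨M, hM, hdom⟩ := exists_uniform_dominating_bound (fun t : Set.Iic (2 : ℝ≥0) => T t)
    (fun t => hT.monotone t) fun x =>
      let ⟨u, hu0, hu⟩ := hb x
      ⟨u, hu0, fun t => hu t t.2⟩
  obtain ⟨r, hr0, hr⟩ := exists_regulator_of_forall_le_add_smul (g := fun t => T t x - x) (by
    intro δ hδ
    -- This gives ‖u‖ ≤ δ / 2; u is used twice, for T(t)(x - y) and, through T(0) = id, for x - y.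
    have hc : 0 < δ / (2 * M) := by positivity
    obtain ⟨w, hw0, hw⟩ := hb x
    obtain ⟨y, v, hv0, hxy, hy⟩ := hT.exists_approx_abs_sub_le_smul hw0 hw hc
    obtain ⟨u, hu0, hun, hu⟩ := hdom _ hc _ hxy
    refine ⟨u + u, v, add_nonneg hu0 hu0, hv0, ?_, fun t ht => ?_⟩
    · have : M * (δ / (2 * M)) = δ / 2 := by field_simp
      linarith [norm_add_le u u]
    · have h1 : |T t (x - y)| ≤ u := hu ⟨t, ht.trans one_le_two⟩
      have h0 : |x - y| ≤ u := by
        simpa [hT.map_zero] using hu ⟨0, Set.mem_Iic.2 zero_le⟩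
      have hsplit : T t x - x = T t (x - y) + -(x - y) + (T t y - y) := by
        rw [map_sub]
        abel
      change |T t x - x| ≤ _
      rw [hsplit]
      refine (abs_add_le _ _).trans (add_le_add ((abs_add_le _ _).trans (add_le_add h1 ?_)) (hy t ht))
      rwa [abs_neg])
  refine ⟨r, hr0, fun ε hε => ?_⟩
  obtain ⟨s, hs, hst⟩ := hr ε hε
  exact ⟨OrderDual.toDual ⟨s, hs⟩, fun j hj => hst _ hj⟩

end IsPositiveC0Semigroup

end BanachLattice

/-- `E` is an arbitrary real Banach lattice. -/
theorem theorem2p1 {E : Type u} [NormedAddCommGroup E] [NormedSpace ℝ E] [CompleteSpace E]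
    [Lattice E] [IsOrderedAddMonoid E] [IsOrderedModule ℝ E] [HasSolidNorm E]
    (T : ℝ≥0 → E →L[ℝ] E) (hT : IsPositiveC0Semigroup T) :
    List.TFAE [
      ∀ x : E, NetRUConverges (fun j : TimeToZero => T j.time x) x,
      ∀ x : E, NetOrderConverges (fun j : TimeToZero => T j.time x) x,
      ∀ x : E, ∃ tx : ℝ≥0, 0 < tx ∧ IsOrderBdd ((fun t => T t x) '' Set.Icc 0 tx),
      ∀ x : E, ∀ t₀ : ℝ≥0, 0 < t₀ → IsOrderBdd ((fun t => T t x) '' Set.Icc 0 t₀)] := by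
  tfae_have 1 → 2 := fun h x => (h x).netOrderConverges
  tfae_have 2 → 3 := fun h x => hT.isOrderBdd_of_netOrderConverges (h x)
  tfae_have 3 → 4 := fun h x t₀ _ =>
    let ⟨_, hs, hb⟩ := h x
    hT.isOrderBdd_orbit_of_local hs hb t₀
  tfae_have 4 → 1 := hT.netRUConverges_of_isOrderBdd
  tfae_finish
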